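/- Let $G$ be a Lie group of real dimension $6$ with Lie algebra $\mathfrak g$, with a fixed left-invariant Riemannian metric $g$, Levi-Civita connection $\nabla$ and a fixed orientation of $\mathfrak g$. Let $\mathcal Z$ be the set of left-invariant almost complex structures $J$ on $G$ that are orthogonal relative to $g$ and positively oriented, and let $\omega(X,Y)=g(JX,Y)$ be the fundamental $2$-form of $J$. Let $\mathcal W=\mathcal W_1\oplus\mathcal W_2\oplus\mathcal W_3\oplus\mathcal W_4$ be the Gray–Hervella decomposition of the space $\mathcal W$ of tensors $T\in\mathfrak g^*\otimes\Lambda^2\mathfrak g^*$ with the symmetries $T(X,Y,Z)=-T(X,Z,Y)=-T(X,JY,JZ)$ of $\nabla\omega$, and let $$\mathcal Z_{134}=\{J\in\mathcal Z:\ \nabla\omega\in\mathcal W_1\oplus\mathcal W_3\oplus\mathcal W_4\}.$$ Let $J\in\mathcal Z$, and let $(\alpha,\beta,\gamma)$ be any basis of the left-invariant $(1,0)$-forms of $J$ (the complex covectors $\theta$ with $\theta\circ J=i\theta$) for which $$\omega=\tfrac12 i\,(\alpha\wedge\bar\alpha+\beta\wedge\bar\beta+\gamma\wedge\bar\gamma).$$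 Then $J\in\mathcal Z_{134}$ if and only if all of the following equations hold, in which the wedge signs between forms are omitted: $$(d\alpha)\gamma\alpha\beta\bar\beta=0,\qquad (d\alpha)\alpha\beta\gamma\bar\gamma=0,\qquad (d\beta)\alpha\beta\gamma\bar\gamma=0,$$ $$(d\beta)\beta\gamma\alpha\bar\alpha=0,\qquad (d\gamma)\beta\gamma\alpha\bar\alpha=0,\qquad (d\gamma)\gamma\alpha\beta\bar\beta=0,$$ $$(d\alpha)\beta\gamma\alpha\bar\alpha=(d\beta)\gamma\alpha\beta\bar\beta=(d\gamma)\alpha\beta\gamma\bar\gamma.$$ -/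

import Mathlib

open scoped Manifold ContDiff Bundle

noncomputable section

namespace AlmostHermitian

/-! ### Linear algebra: the Gray-Hervella decomposition `𝒲 = 𝒲₁ ⊕ 𝒲₂ ⊕ 𝒲₃ ⊕ 𝒲₄`

`V` is a real vector space, `g` an inner product on it and `J` an orthogonal complex structure. -/

section GrayHervella

variable {V : Type*} [AddCommGroup V] [Module ℝ V]

/-- `g` is a (positive definite) inner product. -/
structure IsInnerProduct (g : V →ₗ[ℝ] V →ₗ[ℝ] ℝ) : Prop where
  symm : ∀ u v, g u v = g v u
  pos : ∀ v, v ≠ 0 → 0 < g v v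

/-- `J` is a complex structure that is orthogonal relative to `g`. -/
structure IsOrthogonalComplexStructure (g : V →ₗ[ℝ] V →ₗ[ℝ] ℝ) (J : V →ₗ[ℝ] V) : Prop where
  sq : ∀ v, J (J v) = -v
  orthogonal : ∀ u v, g (J u) (J v) = g u v

/-- The fundamental 2-form `ω(X, Y) = g(JX, Y)`. -/
def fundamentalForm (g : V →ₗ[ℝ] V →ₗ[ℝ] ℝ) (J : V →ₗ[ℝ] V) : V →ₗ[ℝ] V →ₗ[ℝ] ℝ :=
  g ∘ₗ J

/-- The space `𝒲 ⊆ V* ⊗ Λ²V*` of the tensors with the symmetries of `∇ω`: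
`T(x, y, z) = -T(x, z, y) = -T(x, Jy, Jz)`. -/
def spaceW (J : V →ₗ[ℝ] V) : Submodule ℝ (V →ₗ[ℝ] V →ₗ[ℝ] V →ₗ[ℝ] ℝ) where
  carrier := {T | (∀ x y z, T x y z = -T x z y) ∧ ∀ x y z, T x y z = -T x (J y) (J z)}
  zero_mem' := by simp
  add_mem' := by
    rintro S T ⟨hS, hS'⟩ ⟨hT, hT'⟩
    refine ⟨fun x y z => ?_, fun x y z => ?_⟩
    · simp only [LinearMap.add_apply]; rw [hS, hT]; ring
    · simp only [LinearMap.add_apply]; rw [hS', hT']; ring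
  smul_mem' := by
    rintro c T ⟨hT, hT'⟩
    refine ⟨fun x y z => ?_, fun x y z => ?_⟩
    · simp only [LinearMap.smul_apply, smul_eq_mul]; rw [hT]; ring
    · simp only [LinearMap.smul_apply, smul_eq_mul]; rw [hT']; ring

/-- `𝒲₁`: the tensors in `𝒲` with `T(x, x, z) = 0`. -/
def spaceW1 (J : V →ₗ[ℝ] V) : Submodule ℝ (V →ₗ[ℝ] V →ₗ[ℝ] V →ₗ[ℝ] ℝ) where
  carrier := {T | T ∈ spaceW J ∧ ∀ x z, T x x z = 0}
  zero_mem' := ⟨zero_mem _, by simp⟩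
  add_mem' := by
    rintro S T ⟨hS, hS'⟩ ⟨hT, hT'⟩
    exact ⟨add_mem hS hT, fun x z => by simp [hS', hT']⟩
  smul_mem' := by
    rintro c T ⟨hT, hT'⟩
    exact ⟨Submodule.smul_mem _ c hT, fun x z => by simp [hT']⟩

/-- `𝒲₃`: the tensors in `𝒲` with `T(x, y, z) = T(Jx, Jy, z)` and with vanishing contraction
`∑ᵢ T(eᵢ, eᵢ, z)`, where `(eᵢ)` is a `g`-orthonormal basis. -/
def spaceW3 (g : V →ₗ[ℝ] V →ₗ[ℝ] ℝ) (J : V →ₗ[ℝ] V) :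
    Submodule ℝ (V →ₗ[ℝ] V →ₗ[ℝ] V →ₗ[ℝ] ℝ) where
  carrier := {T | T ∈ spaceW J ∧ (∀ x y z, T x y z = T (J x) (J y) z) ∧
    ∀ (n : ℕ) (e : Module.Basis (Fin n) ℝ V), (∀ i j, g (e i) (e j) = if i = j then 1 else 0) →
      ∀ z, ∑ i, T (e i) (e i) z = 0}
  zero_mem' := ⟨zero_mem _, by simp, by simp⟩
  add_mem' := by
    rintro S T ⟨hS, hS', hS''⟩ ⟨hT, hT', hT''⟩
    refine ⟨add_mem hS hT, fun x y z => ?_, fun n e he z => ?_⟩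
    · simp only [LinearMap.add_apply]; rw [hS', hT']
    · simp only [LinearMap.add_apply]
      rw [Finset.sum_add_distrib, hS'' n e he, hT'' n e he, add_zero]
  smul_mem' := by
    rintro c T ⟨hT, hT', hT''⟩
    refine ⟨Submodule.smul_mem _ c hT, fun x y z => ?_, fun n e he z => ?_⟩
    · simp only [LinearMap.smul_apply]; rw [hT']
    · simp only [LinearMap.smul_apply]
      rw [← Finset.smul_sum, hT'' n e he, smul_zero]

/-- `𝒲₄`: the tensors
`T(x, y, z) = g(x, y)θ(z) - g(x, z)θ(y) - g(x, Jy)θ(Jz) + g(x, Jz)θ(Jy)` with `θ ∈ V*`.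
(In dimension `2n` the contraction `∑ᵢ T(eᵢ, eᵢ, z)` of such a tensor is `2(n - 1)θ(z)`.) -/
def spaceW4 (g : V →ₗ[ℝ] V →ₗ[ℝ] ℝ) (J : V →ₗ[ℝ] V) :
    Submodule ℝ (V →ₗ[ℝ] V →ₗ[ℝ] V →ₗ[ℝ] ℝ) where
  carrier := {T | T ∈ spaceW J ∧ ∃ θ : V →ₗ[ℝ] ℝ, ∀ x y z,
    T x y z = g x y * θ z - g x z * θ y - g x (J y) * θ (J z) + g x (J z) * θ (J y)}
  zero_mem' := ⟨zero_mem _, 0, by simp⟩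
  add_mem' := by
    rintro S T ⟨hS, θ, hθ⟩ ⟨hT, η, hη⟩
    refine ⟨add_mem hS hT, θ + η, fun x y z => ?_⟩
    simp only [LinearMap.add_apply, hθ, hη]; ring
  smul_mem' := by
    rintro c T ⟨hT, θ, hθ⟩
    refine ⟨Submodule.smul_mem _ c hT, c • θ, fun x y z => ?_⟩
    simp only [LinearMap.smul_apply, hθ, smul_eq_mul]; ring

end GrayHervella

/-! ### Complex-valued forms on a real vector space -/

section Forms

variable {V : Type*} [AddCommGroup V] [Module ℝ V]

/-- The wedge product `ψ ∧ θ` of an `n`-form and a 1-form: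
`(ψ ∧ θ)(v₀, …, vₙ) = ∑ₚ (-1)ⁿ⁻ᵖ ψ(v₀, …, v̂ₚ, …, vₙ) θ(vₚ)`. -/
def wedge {n : ℕ} (ψ : V [⋀^Fin n]→ₗ[ℝ] ℂ) (θ : V →ₗ[ℝ] ℂ) : V [⋀^Fin (n + 1)]→ₗ[ℝ] ℂ :=
  (-1 : ℂ) ^ n • AlternatingMap.alternatizeUncurryFin (θ.smulRight ψ)

/-- Infix notation for the wedge product with a 1-form, associating to the left. -/
infixl:70 " ⋏ " => wedge

/-- A covector, seen as an alternating form of degree 1. -/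
def oneForm (θ : V →ₗ[ℝ] ℂ) : V [⋀^Fin 1]→ₗ[ℝ] ℂ :=
  AlternatingMap.ofSubsingleton ℝ V ℂ (0 : Fin 1) θ

/-- The complex conjugate of a complex covector. -/
def bar (θ : V →ₗ[ℝ] ℂ) : V →ₗ[ℝ] ℂ := Complex.conjAe.toLinearMap ∘ₗ θ

/-- The space `Λ^{1,0}` of the covectors of type (1,0), that is, the `i`-eigenspace of the
action `θ ↦ θ ∘ J` of `J` on `V* ⊗ ℂ`. -/
def formsOneZero (J : V →ₗ[ℝ] V) : Submodule ℂ (V →ₗ[ℝ] ℂ) where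
  carrier := {θ | ∀ v, θ (J v) = Complex.I * θ v}
  zero_mem' := by simp
  add_mem' := by
    intro θ η hθ hη v
    simp only [LinearMap.add_apply, hθ v, hη v]; ring
  smul_mem' := by
    intro c θ hθ v
    simp only [LinearMap.smul_apply, hθ v, smul_eq_mul]; ring

/-- `(α, β, γ)` is a basis of the space of (1,0)-forms, for which the fundamental 2-form is
`ω = ½ i (α ∧ ᾱ + β ∧ β̄ + γ ∧ γ̄)`. -/
structure IsUnitaryBasis (g : V →ₗ[ℝ] V →ₗ[ℝ] ℝ) (J : V →ₗ[ℝ] V) (α β γ : V →ₗ[ℝ] ℂ) :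
    Prop where
  linearIndependent : LinearIndependent ℂ ![α, β, γ]
  span_eq : Submodule.span ℂ {α, β, γ} = formsOneZero J
  fundamentalForm_eq : ∀ X Y, (fundamentalForm g J X Y : ℂ) =
    1 / 2 * Complex.I *
      (oneForm α ⋏ bar α + oneForm β ⋏ bar β + oneForm γ ⋏ bar γ) ![X, Y]

end Forms

/-! ### Invariant tensors on a 6-dimensional Lie group

Left-invariant tensors on `G` are given by their values at the identity, that is, by tensors on
the Lie algebra `𝔤 = T₁G`. The left-invariant vector field with value `X` at the identity is
Mathlib's `mulInvariantVectorField X`, and the bracket of `𝔤` is the one of these fields. -/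

section LieGroup

variable {G : Type*} [TopologicalSpace G] [ChartedSpace (EuclideanSpace ℝ (Fin 6)) G] [Group G]

/-- The differential at `x` of the left translation by `x⁻¹`. -/
def toLieAlgebra (x : G) : TangentSpace (𝓡 6) x →ₗ[ℝ] GroupLieAlgebra (𝓡 6) G :=
  (mfderiv (𝓡 6) (𝓡 6) (fun y : G => x⁻¹ * y) x :
    TangentSpace (𝓡 6) x →L[ℝ] TangentSpace (𝓡 6) (x⁻¹ * x)).toLinearMap

/-- The value at `x` of the left-invariant covariant 2-tensor with value `b` at the identity. -/
def invariantTensor (b : GroupLieAlgebra (𝓡 6) G →ₗ[ℝ] GroupLieAlgebra (𝓡 6) G →ₗ[ℝ] ℝ)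
    (x : G) (u v : TangentSpace (𝓡 6) x) : ℝ :=
  b (toLieAlgebra x u) (toLieAlgebra x v)

variable [LieGroup (𝓡 6) ∞ G]

instance instLieGroupMinSmoothness : LieGroup (𝓡 6) (minSmoothness ℝ 3) G := by
  rw [minSmoothness_of_isRCLikeNormedField]
  infer_instance

/-- The exterior derivative `dα ∈ Λ²𝔤* ⊗ ℂ` of the left-invariant 1-form `α`. In
`dα(X, Y) = X(α(Y)) - Y(α(X)) - α([X, Y])` the first two terms vanish for left-invariant fields
`X` and `Y`, because then `α(X)` and `α(Y)` are constant. -/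
def dForm (α : GroupLieAlgebra (𝓡 6) G →ₗ[ℝ] ℂ) :
    GroupLieAlgebra (𝓡 6) G [⋀^Fin 2]→ₗ[ℝ] ℂ where
  toFun v := -α ⁅v 0, v 1⁆
  map_update_add' := by
    intro _ v i X Y
    fin_cases i
    · simp [add_lie]; ring
    · simp [lie_add]; ring
  map_update_smul' := by
    intro _ v i c X
    fin_cases i
    · simp [smul_lie]
    · simp [lie_smul]
  map_eq_zero_of_eq' := by
    intro v i j h hij
    fin_cases i <;> fin_cases j <;> simp_all [lie_self]

/-- The vector field `X` on `G` is differentiable at `x`. -/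
def IsDifferentiableField (X : ∀ y : G, TangentSpace (𝓡 6) y) (x : G) : Prop :=
  MDifferentiableAt (𝓡 6) (𝓡 6).tangent (fun y => (⟨y, X y⟩ : TangentBundle (𝓡 6) G)) x

/-- `cov` is the Levi-Civita connection of the left-invariant metric `g`: it has no torsion,
`∇_X Y - ∇_Y X = [X, Y]`, and it is metric, `X g(Y, Z) = g(∇_X Y, Z) + g(Y, ∇_X Z)`.
(In Mathlib's notation `∇_X Y` is `cov Y x (X x)` at the point `x`.) -/
structure IsLeviCivita (g : GroupLieAlgebra (𝓡 6) G →ₗ[ℝ] GroupLieAlgebra (𝓡 6) G →ₗ[ℝ] ℝ)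
    (cov : CovariantDerivative (𝓡 6) (EuclideanSpace ℝ (Fin 6))
      (TangentSpace (𝓡 6) : G → Type _)) : Prop where
  torsion_free : ∀ (X Y : ∀ y : G, TangentSpace (𝓡 6) y) (x : G),
    IsDifferentiableField X x → IsDifferentiableField Y x →
      cov Y x (X x) - cov X x (Y x) = VectorField.mlieBracket (𝓡 6) X Y x
  metric : ∀ (X Y Z : ∀ y : G, TangentSpace (𝓡 6) y) (x : G),
    IsDifferentiableField Y x → IsDifferentiableField Z x →
      mvfderiv (𝓡 6) (fun y => invariantTensor g y (Y y) (Z y)) x (X x) =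
        invariantTensor g x (cov Y x (X x)) (Z x) + invariantTensor g x (Y x) (cov Z x (X x))

/-- `(∇_X b)(Y, Z) = X(b(Y, Z)) - b(∇_X Y, Z) - b(Y, ∇_X Z)` at the point `x`, for the
left-invariant 2-tensor `b` and the left-invariant vector fields `X`, `Y`, `Z`. -/
def covDeriv (cov : CovariantDerivative (𝓡 6) (EuclideanSpace ℝ (Fin 6))
      (TangentSpace (𝓡 6) : G → Type _))
    (b : GroupLieAlgebra (𝓡 6) G →ₗ[ℝ] GroupLieAlgebra (𝓡 6) G →ₗ[ℝ] ℝ) (x : G)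
    (X Y Z : GroupLieAlgebra (𝓡 6) G) : ℝ :=
  mvfderiv (𝓡 6) (fun y : G => invariantTensor b y (mulInvariantVectorField Y y)
      (mulInvariantVectorField Z y)) x (mulInvariantVectorField X x)
    - invariantTensor b x (cov (mulInvariantVectorField Y) x (mulInvariantVectorField X x))
      (mulInvariantVectorField Z x)
    - invariantTensor b x (mulInvariantVectorField Y x)
      (cov (mulInvariantVectorField Z) x (mulInvariantVectorField X x))

/-- The set `𝒵` of the left-invariant almost complex structures that are orthogonal relative to
`g` and positively oriented: some basis `(e₁, Je₁, e₃, Je₃, e₅, Je₅)` has the orientation `o`. -/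
def classZ (g : GroupLieAlgebra (𝓡 6) G →ₗ[ℝ] GroupLieAlgebra (𝓡 6) G →ₗ[ℝ] ℝ)
    (o : Orientation ℝ (GroupLieAlgebra (𝓡 6) G) (Fin 6)) :
    Set (GroupLieAlgebra (𝓡 6) G →ₗ[ℝ] GroupLieAlgebra (𝓡 6) G) :=
  {J | IsOrthogonalComplexStructure g J ∧
    ∃ e : Module.Basis (Fin 6) ℝ (GroupLieAlgebra (𝓡 6) G),
      e 1 = J (e 0) ∧ e 3 = J (e 2) ∧ e 5 = J (e 4) ∧ e.orientation = o}

/-- The class `𝒵₁₃₄` of the `J ∈ 𝒵` for which `∇ω` belongs to `𝒲₁ ⊕ 𝒲₃ ⊕ 𝒲₄` at every point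
of `G`, where tangent spaces are identified with `𝔤` by left translations. -/
def classZ134 (g : GroupLieAlgebra (𝓡 6) G →ₗ[ℝ] GroupLieAlgebra (𝓡 6) G →ₗ[ℝ] ℝ)
    (o : Orientation ℝ (GroupLieAlgebra (𝓡 6) G) (Fin 6))
    (cov : CovariantDerivative (𝓡 6) (EuclideanSpace ℝ (Fin 6))
      (TangentSpace (𝓡 6) : G → Type _)) :
    Set (GroupLieAlgebra (𝓡 6) G →ₗ[ℝ] GroupLieAlgebra (𝓡 6) G) :=
  {J | J ∈ classZ g o ∧ ∀ x : G, ∃ T ∈ spaceW1 J ⊔ spaceW3 g J ⊔ spaceW4 g J,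
    ∀ X Y Z, T X Y Z = covDeriv cov (fundamentalForm g J) x X Y Z}

end LieGroup

end AlmostHermitian

end

/-! Everything is left-invariant, so `∇ω` is one tensor on the Lie algebra, given by the Koszul
formula (`IsLeviCivita.covDeriv_fundamentalForm`). A tensor `T ∈ 𝒲` has no `𝒲₂` component exactly
when `T(x, x, z) = T(Jx, Jx, z)` (`mem_spaceW134_iff`). For `∇ω` the difference of the two sides
involves only the brackets that make up the (0,2)-parts of `dα, dβ, dγ`: up to sign it is the
imaginary part of `∑ₖ 4(dθₖ)^{0,2}(z, x) θ̄ₖ(x)`, where `θₖ` runs over `α, β, γ`. Replacing `z` by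
`Jz` multiplies this sum by `-i`, so the condition is that the complex sum vanishes for all `x, z`.

In complex dimension 3 the (0,2)-forms have basis `β̄γ̄, γ̄ᾱ, ᾱβ̄`, so the three (0,2)-parts form a
3 × 3 matrix `M`. The sum becomes, up to a factor, the pairing of `Mᵀx̄` with the cross product `z̄
× x̄`. It vanishes for all `z` iff `Mᵀx̄` is proportional to `x̄`; for this to hold for all `x`, `M`
must be scalar (`IsUnitaryBasis.contractedZeroTwo_eq_zero_iff`).

Wedging a 2-form with `βγαᾱ`, `γαββ̄` or `αβγγ̄` isolates one of its (0,2)-components, always with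
the same constant. Hence the six vanishing equations say that `M` is diagonal, and the last chain
that its diagonal entries agree. -/

noncomputable section

namespace AlmostHermitian

/-! ### Tensors in `𝒲` without `𝒲₂` component -/

section TensorDecomposition

variable {V : Type*} [AddCommGroup V] [Module ℝ V]

/-- The trilinear map given by a function that is linear in each of its three arguments. -/
def mkTrilinear (f : V → V → V → ℝ)
    (add₁ : ∀ x x' y z, f (x + x') y z = f x y z + f x' y z)
    (smul₁ : ∀ (c : ℝ) x y z, f (c • x) y z = c * f x y z)
    (add₂ : ∀ x y y' z, f x (y + y') z = f x y z + f x y' z)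
    (smul₂ : ∀ (c : ℝ) x y z, f x (c • y) z = c * f x y z)
    (add₃ : ∀ x y z z', f x y (z + z') = f x y z + f x y z')
    (smul₃ : ∀ (c : ℝ) x y z, f x y (c • z) = c * f x y z) :
    V →ₗ[ℝ] V →ₗ[ℝ] V →ₗ[ℝ] ℝ where
  toFun x := LinearMap.mk₂ ℝ (f x) (add₂ x) (fun c y z => smul₂ c x y z) (add₃ x)
    (fun c y z => smul₃ c x y z)
  map_add' x x' := by ext y z; simp [add₁]
  map_smul' c x := by ext y z; simp [smul₁]

variable {g : V →ₗ[ℝ] V →ₗ[ℝ] ℝ} {J : V →ₗ[ℝ] V}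

theorem IsOrthogonalComplexStructure.apply_left (hJ : IsOrthogonalComplexStructure g J)
    (u v : V) : g (J u) v = -g u (J v) := by
  have h := hJ.orthogonal u (J v)
  rw [hJ.sq, map_neg] at h
  linarith

theorem IsOrthogonalComplexStructure.apply_self (hJ : IsOrthogonalComplexStructure g J)
    (hg : IsInnerProduct g) (u : V) : g u (J u) = 0 := by
  have h := hJ.apply_left u u
  rw [hg.symm] at h
  linarith

/-- The tensor in `𝒲₄` associated with the covector `θ`. -/
def leeTensor (g : V →ₗ[ℝ] V →ₗ[ℝ] ℝ) (J : V →ₗ[ℝ] V) (θ : V →ₗ[ℝ] ℝ) :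
    V →ₗ[ℝ] V →ₗ[ℝ] V →ₗ[ℝ] ℝ :=
  mkTrilinear (fun x y z =>
      g x y * θ z - g x z * θ y - g x (J y) * θ (J z) + g x (J z) * θ (J y))
    (fun _ _ _ _ => by simp; ring) (fun _ _ _ _ => by simp; ring)
    (fun _ _ _ _ => by simp; ring) (fun _ _ _ _ => by simp; ring)
    (fun _ _ _ _ => by simp; ring) (fun _ _ _ _ => by simp; ring)

theorem leeTensor_apply (g : V →ₗ[ℝ] V →ₗ[ℝ] ℝ) (J : V →ₗ[ℝ] V) (θ : V →ₗ[ℝ] ℝ) (x y z : V) :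
    leeTensor g J θ x y z =
      g x y * θ z - g x z * θ y - g x (J y) * θ (J z) + g x (J z) * θ (J y) := rfl

theorem leeTensor_mem (hJ : IsOrthogonalComplexStructure g J) (θ : V →ₗ[ℝ] ℝ) :
    leeTensor g J θ ∈ spaceW4 g J := by
  refine ⟨⟨fun x y z => ?_, fun x y z => ?_⟩, θ, fun x y z => rfl⟩
  · simp only [leeTensor_apply]; ring
  · simp only [leeTensor_apply, hJ.sq, map_neg]; ring

/-- The tensor `(x, y, z) ↦ T(Jx, Jy, z)`. -/
def twist (J : V →ₗ[ℝ] V) (T : V →ₗ[ℝ] V →ₗ[ℝ] V →ₗ[ℝ] ℝ) : V →ₗ[ℝ] V →ₗ[ℝ] V →ₗ[ℝ] ℝ :=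
  T.compl₁₂ J J

@[simp]
theorem twist_apply (J : V →ₗ[ℝ] V) (T : V →ₗ[ℝ] V →ₗ[ℝ] V →ₗ[ℝ] ℝ) (x y z : V) :
    twist J T x y z = T (J x) (J y) z := rfl

theorem apply_J_left_of_mem_spaceW (hJ : ∀ v, J (J v) = -v)
    {T : V →ₗ[ℝ] V →ₗ[ℝ] V →ₗ[ℝ] ℝ} (hT : T ∈ spaceW J) (x y z : V) :
    T x (J y) z = T x y (J z) := by
  rw [hT.2 x (J y) z, hJ]; simp

theorem twist_mem_spaceW (hJ : ∀ v, J (J v) = -v)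
    {T : V →ₗ[ℝ] V →ₗ[ℝ] V →ₗ[ℝ] ℝ} (hT : T ∈ spaceW J) : twist J T ∈ spaceW J := by
  refine ⟨fun x y z => ?_, fun x y z => ?_⟩
  · simp only [twist_apply]
    rw [apply_J_left_of_mem_spaceW hJ hT, hT.1]
  · simp only [twist_apply]
    rw [hT.2]


theorem repr_eq_of_orthonormal {n : ℕ} (e : Module.Basis (Fin n) ℝ V)
    (he : ∀ i j, g (e i) (e j) = if i = j then 1 else 0) (v : V) (i : Fin n) :
    g (e i) v = e.repr v i := by
  conv_lhs => rw [← e.sum_repr v]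
  simp only [map_sum, map_smul, he, smul_eq_mul, mul_ite, mul_one, mul_zero,
    Finset.sum_ite_eq, Finset.mem_univ, if_true]

theorem sum_smul_of_orthonormal {n : ℕ} (e : Module.Basis (Fin n) ℝ V)
    (he : ∀ i j, g (e i) (e j) = if i = j then 1 else 0) (v : V) :
    ∑ i, g (e i) v • e i = v := by
  simp only [repr_eq_of_orthonormal e he, e.sum_repr]

/-- Expand one argument in the other basis on each side; symmetry of `g` identifies the double sums.
`spaceW3` quantifies over all orthonormal bases, and this reduces its trace condition to one of
them. -/
theorem contraction_eq_of_orthonormal (hg : IsInnerProduct g) {n m : ℕ}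
    (e : Module.Basis (Fin n) ℝ V) (he : ∀ i j, g (e i) (e j) = if i = j then 1 else 0)
    (f : Module.Basis (Fin m) ℝ V) (hf : ∀ i j, g (f i) (f j) = if i = j then 1 else 0)
    (B : V →ₗ[ℝ] V →ₗ[ℝ] ℝ) : ∑ i, B (f i) (f i) = ∑ j, B (e j) (e j) := by
  have h₁ : ∀ i, B (f i) (f i) = ∑ j, g (e j) (f i) * B (e j) (f i) := fun i => by
    have h := congrArg (fun v => B v (f i)) (sum_smul_of_orthonormal e he (f i))
    simpa only [map_sum, map_smul, LinearMap.sum_apply, LinearMap.smul_apply, smul_eq_mul]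
      using h.symm
  have h₂ : ∀ j, B (e j) (e j) = ∑ i, g (f i) (e j) * B (e j) (f i) := fun j => by
    have h := congrArg (B (e j)) (sum_smul_of_orthonormal f hf (e j))
    simpa only [map_sum, map_smul, smul_eq_mul] using h.symm
  simp only [h₁, h₂]
  rw [Finset.sum_comm]
  simp only [hg.symm]

/-- The four terms contribute `nθ(z)`, `-θ(z)`, `0` (since `g(e, Je) = 0`) and `-θ(z)`. -/
theorem contraction_leeTensor (hg : IsInnerProduct g) (hJ : IsOrthogonalComplexStructure g J)
    {n : ℕ} (e : Module.Basis (Fin n) ℝ V)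
    (he : ∀ i j, g (e i) (e j) = if i = j then 1 else 0) (θ : V →ₗ[ℝ] ℝ) (z : V) :
    ∑ i, leeTensor g J θ (e i) (e i) z = (n - 2) * θ z := by
  have h : ∀ (η : V →ₗ[ℝ] ℝ) v, ∑ i, g (e i) v * η (e i) = η v := fun η v => by
    conv_rhs => rw [← sum_smul_of_orthonormal e he v]
    simp
  have h₁ := h θ z
  have h₂ := h (θ ∘ₗ J) (J z)
  simp only [LinearMap.comp_apply, hJ.sq, map_neg] at h₂
  simp only [leeTensor_apply, hJ.apply_self hg, he, Finset.sum_add_distrib,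
    Finset.sum_sub_distrib, h₁, h₂]
  simp
  ring

/-- A tensor `T ∈ 𝒲` has no component in `𝒲₂` if and only if the part of it that satisfies
`T(Jx, Jy, z) = -T(x, y, z)` is totally antisymmetric. -/
theorem mem_spaceW134_iff (hg : IsInnerProduct g) (hJ : IsOrthogonalComplexStructure g J)
    {n : ℕ} (hn : n ≠ 2) (e : Module.Basis (Fin n) ℝ V)
    (he : ∀ i j, g (e i) (e j) = if i = j then 1 else 0)
    {T : V →ₗ[ℝ] V →ₗ[ℝ] V →ₗ[ℝ] ℝ} (hT : T ∈ spaceW J) :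
    T ∈ spaceW1 J ⊔ spaceW3 g J ⊔ spaceW4 g J ↔ ∀ x z, T x x z = T (J x) (J x) z := by
  constructor
  · intro h x z
    obtain ⟨S, hS, T₄, ⟨-, θ, hθ⟩, rfl⟩ := Submodule.mem_sup.1 h
    obtain ⟨T₁, hT₁, T₃, hT₃, rfl⟩ := Submodule.mem_sup.1 hS
    simp only [LinearMap.add_apply, hT₁.2, ← hT₃.2.1 x x z, hθ, hJ.orthogonal, hJ.sq, map_neg,
      hJ.apply_left]
    ring
  · intro h
    have hJT := twist_mem_spaceW hJ.sq hT
    -- `A` and `B` are the parts of `T` that are odd and even under `twist J`. The hypothesis puts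
    -- `A` in `𝒲₁`; the trace of `B` then splits it between `𝒲₃` and `𝒲₄`.
    set A : V →ₗ[ℝ] V →ₗ[ℝ] V →ₗ[ℝ] ℝ := (1 / 2 : ℝ) • T + (-1 / 2 : ℝ) • twist J T with hA
    set B : V →ₗ[ℝ] V →ₗ[ℝ] V →ₗ[ℝ] ℝ := (1 / 2 : ℝ) • T + (1 / 2 : ℝ) • twist J T with hB
    have hAW : A ∈ spaceW J :=
      add_mem (Submodule.smul_mem _ _ hT) (Submodule.smul_mem _ _ hJT)
    have hBW : B ∈ spaceW J :=
      add_mem (Submodule.smul_mem _ _ hT) (Submodule.smul_mem _ _ hJT)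
    have hA₁ : A ∈ spaceW1 J := ⟨hAW, fun x z => by simp [hA, h x z]; ring⟩
    have hBJ : ∀ x y z, B x y z = B (J x) (J y) z := fun x y z => by
      simp [hB, hJ.sq, add_comm]
    set τ : V →ₗ[ℝ] ℝ := ∑ i, B (e i) (e i) with hτ
    -- The factor `1 / (n - 2)` gives `L` the same contraction as `B`; this is where `n ≠ 2` is
    -- needed.
    set L := leeTensor g J ((1 / (n - 2) : ℝ) • τ) with hL
    have hL₄ : L ∈ spaceW4 g J := leeTensor_mem hJ _
    have hn' : (n - 2 : ℝ) ≠ 0 := sub_ne_zero.2 (by exact_mod_cast hn)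
    have hB₃ : B + (-1 : ℝ) • L ∈ spaceW3 g J := by
      refine ⟨add_mem hBW (Submodule.smul_mem _ _ hL₄.1), fun x y z => ?_, fun m f hf z => ?_⟩
      · simp only [LinearMap.add_apply, LinearMap.smul_apply]
        rw [hBJ x y z]
        simp only [hL, leeTensor_apply, hJ.orthogonal, hJ.sq, map_neg, hJ.apply_left]
        ring
      · have key := contraction_eq_of_orthonormal hg e he f hf
          ((B + (-1 : ℝ) • L).compr₂ (LinearMap.applyₗ z))
        simp only [LinearMap.compr₂_apply, LinearMap.applyₗ_apply_apply] at key
        rw [key]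
        simp only [LinearMap.add_apply, LinearMap.smul_apply, Finset.sum_add_distrib,
          ← Finset.smul_sum]
        rw [contraction_leeTensor hg hJ e he]
        simp only [hτ, LinearMap.smul_apply, LinearMap.sum_apply, smul_eq_mul]
        field_simp
        ring
    have hsum : T = A + (B + (-1 : ℝ) • L) + L := by
      ext x y z
      simp only [hA, hB, LinearMap.add_apply, LinearMap.smul_apply, smul_eq_mul]
      ring
    rw [hsum]
    exact Submodule.add_mem_sup (Submodule.add_mem_sup hA₁ hB₃) hL₄

end TensorDecomposition

/-! ### Explicit values of wedge products -/

section WedgeEvaluation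

variable {V : Type*} [AddCommGroup V] [Module ℝ V]

theorem wedge_apply {n : ℕ} (ψ : V [⋀^Fin n]→ₗ[ℝ] ℂ) (θ : V →ₗ[ℝ] ℂ) (v : Fin (n + 1) → V) :
    (ψ ⋏ θ) v = (-1) ^ n * ∑ p : Fin (n + 1), (-1) ^ (p : ℕ) * (θ (v p) * ψ (p.removeNth v)) := by
  simp [wedge, AlternatingMap.alternatizeUncurryFin_apply]

theorem oneForm_wedge_apply (θ η : V →ₗ[ℝ] ℂ) (x y : V) :
    (oneForm θ ⋏ η) ![x, y] = θ x * η y - θ y * η x := by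
  simp [wedge_apply, Fin.sum_univ_succ, oneForm, Fin.removeNth]
  ring

theorem wedge_apply_three (ψ : V [⋀^Fin 2]→ₗ[ℝ] ℂ) (θ : V →ₗ[ℝ] ℂ) (a b c : V) :
    (ψ ⋏ θ) ![a, b, c] = θ a * ψ ![b, c] - θ b * ψ ![a, c] + θ c * ψ ![a, b] := by
  have h₀ : Fin.removeNth 0 ![a, b, c] = ![b, c] := by ext i; fin_cases i <;> rfl
  have h₁ : Fin.removeNth 1 ![a, b, c] = ![a, c] := by ext i; fin_cases i <;> rfl
  have h₂ : Fin.removeNth 2 ![a, b, c] = ![a, b] := by ext i; fin_cases i <;> rfl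
  rw [wedge_apply, Fin.sum_univ_three, h₀, h₁, h₂]
  simp
  ring

theorem wedge_apply_four (ψ : V [⋀^Fin 3]→ₗ[ℝ] ℂ) (θ : V →ₗ[ℝ] ℂ) (a b c d : V) :
    (ψ ⋏ θ) ![a, b, c, d] = -(θ a * ψ ![b, c, d]) + θ b * ψ ![a, c, d] - θ c * ψ ![a, b, d]
      + θ d * ψ ![a, b, c] := by
  have h₀ : Fin.removeNth 0 ![a, b, c, d] = ![b, c, d] := by ext i; fin_cases i <;> rfl
  have h₁ : Fin.removeNth 1 ![a, b, c, d] = ![a, c, d] := by ext i; fin_cases i <;> rfl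
  have h₂ : Fin.removeNth 2 ![a, b, c, d] = ![a, b, d] := by ext i; fin_cases i <;> rfl
  have h₃ : Fin.removeNth 3 ![a, b, c, d] = ![a, b, c] := by ext i; fin_cases i <;> rfl
  rw [wedge_apply, Fin.sum_univ_four, h₀, h₁, h₂, h₃]
  simp
  ring

theorem wedge_apply_five (ψ : V [⋀^Fin 4]→ₗ[ℝ] ℂ) (θ : V →ₗ[ℝ] ℂ) (a b c d e : V) :
    (ψ ⋏ θ) ![a, b, c, d, e] = θ a * ψ ![b, c, d, e] - θ b * ψ ![a, c, d, e]
      + θ c * ψ ![a, b, d, e] - θ d * ψ ![a, b, c, e] + θ e * ψ ![a, b, c, d] := by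
  have h₀ : Fin.removeNth 0 ![a, b, c, d, e] = ![b, c, d, e] := by
    ext i; fin_cases i <;> rfl
  have h₁ : Fin.removeNth 1 ![a, b, c, d, e] = ![a, c, d, e] := by
    ext i; fin_cases i <;> rfl
  have h₂ : Fin.removeNth 2 ![a, b, c, d, e] = ![a, b, d, e] := by
    ext i; fin_cases i <;> rfl
  have h₃ : Fin.removeNth 3 ![a, b, c, d, e] = ![a, b, c, e] := by
    ext i; fin_cases i <;> rfl
  have h₄ : Fin.removeNth 4 ![a, b, c, d, e] = ![a, b, c, d] := by
    ext i; fin_cases i <;> rfl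
  rw [wedge_apply, Fin.sum_univ_five, h₀, h₁, h₂, h₃, h₄]
  simp
  ring

theorem wedge_apply_six (ψ : V [⋀^Fin 5]→ₗ[ℝ] ℂ) (θ : V →ₗ[ℝ] ℂ) (a b c d e f : V) :
    (ψ ⋏ θ) ![a, b, c, d, e, f] = -(θ a * ψ ![b, c, d, e, f]) + θ b * ψ ![a, c, d, e, f]
      - θ c * ψ ![a, b, d, e, f] + θ d * ψ ![a, b, c, e, f] - θ e * ψ ![a, b, c, d, f]
      + θ f * ψ ![a, b, c, d, e] := by
  have h₀ : Fin.removeNth 0 ![a, b, c, d, e, f] = ![b, c, d, e, f] := by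
    ext i; fin_cases i <;> rfl
  have h₁ : Fin.removeNth 1 ![a, b, c, d, e, f] = ![a, c, d, e, f] := by
    ext i; fin_cases i <;> rfl
  have h₂ : Fin.removeNth 2 ![a, b, c, d, e, f] = ![a, b, d, e, f] := by
    ext i; fin_cases i <;> rfl
  have h₃ : Fin.removeNth 3 ![a, b, c, d, e, f] = ![a, b, c, e, f] := by
    ext i; fin_cases i <;> rfl
  have h₄ : Fin.removeNth 4 ![a, b, c, d, e, f] = ![a, b, c, d, f] := by
    ext i; fin_cases i <;> rfl
  have h₅ : Fin.removeNth 5 ![a, b, c, d, e, f] = ![a, b, c, d, e] := by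
    ext i; fin_cases i <;> rfl
  rw [wedge_apply, Fin.sum_univ_six, h₀, h₁, h₂, h₃, h₄, h₅]
  simp
  ring

@[simp]
theorem bar_apply (θ : V →ₗ[ℝ] ℂ) (v : V) : bar θ v = (starRingEnd ℂ) (θ v) := rfl

/-- Two forms of top degree agree if they agree on a basis. -/
theorem eq_of_apply_basis_eq {n : ℕ} (b : Module.Basis (Fin n) ℝ V)
    {φ ψ : V [⋀^Fin n]→ₗ[ℝ] ℂ} (h : φ b = ψ b) : φ = ψ := by
  refine b.ext_alternating fun i hi => ?_
  -- An injective choice of `n` basis vectors is a permutation, which changes both forms by the same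
  -- sign.
  let σ : Equiv.Perm (Fin n) := Equiv.ofBijective i (Finite.injective_iff_bijective.1 hi)
  have e : (fun j => b (i j)) = b ∘ σ := rfl
  rw [e, φ.map_perm, ψ.map_perm, h]

end WedgeEvaluation

/-! ### Unitary coframes, dual frames and (0,2)-parts of 2-forms -/

section Coframe

theorem update_cons_zero {V : Type*} (x x' y : V) : Function.update ![x, y] 0 x' = ![x', y] := by
  ext i; fin_cases i <;> rfl

variable {V : Type*} [AddCommGroup V] [Module ℝ V]

/-- Four times the (0,2)-part of the 2-form `ψ`. -/
def formZeroTwo (J : V →ₗ[ℝ] V) (ψ : V [⋀^Fin 2]→ₗ[ℝ] ℂ) (x y : V) : ℂ :=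
  ψ ![x, y] - ψ ![J x, J y] + Complex.I * (ψ ![J x, y] + ψ ![x, J y])

/-- The vectors `E₁, E₂, E₃` form a frame dual to the covectors `α, β, γ`. -/
structure IsDualFrame (α β γ : V →ₗ[ℝ] ℂ) (E₁ E₂ E₃ : V) : Prop where
  α₁ : α E₁ = 1
  α₂ : α E₂ = 0
  α₃ : α E₃ = 0
  β₁ : β E₁ = 0
  β₂ : β E₂ = 1
  β₃ : β E₃ = 0
  γ₁ : γ E₁ = 0
  γ₂ : γ E₂ = 0
  γ₃ : γ E₃ = 1

variable {g : V →ₗ[ℝ] V →ₗ[ℝ] ℝ} {J : V →ₗ[ℝ] V} {α β γ : V →ₗ[ℝ] ℂ} {E₁ E₂ E₃ : V}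

theorem two_form_add_left (ψ : V [⋀^Fin 2]→ₗ[ℝ] ℂ) (x x' y : V) :
    ψ ![x + x', y] = ψ ![x, y] + ψ ![x', y] := by
  have h := ψ.map_update_add ![x, y] 0 x x'
  simp only [update_cons_zero] at h
  exact h

theorem two_form_smul_left (ψ : V [⋀^Fin 2]→ₗ[ℝ] ℂ) (c : ℝ) (x y : V) :
    ψ ![c • x, y] = c * ψ ![x, y] := by
  have h := ψ.map_update_smul ![x, y] 0 c x
  simp only [update_cons_zero, Complex.real_smul] at h
  exact h

theorem two_form_swap (ψ : V [⋀^Fin 2]→ₗ[ℝ] ℂ) (x y : V) : ψ ![x, y] = -ψ ![y, x] := by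
  have h := ψ.map_swap ![y, x] (i := 0) (j := 1) (by simp)
  rw [← h]
  congr 1
  ext i; fin_cases i <;> rfl

theorem formZeroTwo_swap (ψ : V [⋀^Fin 2]→ₗ[ℝ] ℂ) (x y : V) :
    formZeroTwo J ψ x y = -formZeroTwo J ψ y x := by
  simp only [formZeroTwo]
  rw [two_form_swap ψ x y, two_form_swap ψ (J x) (J y), two_form_swap ψ (J x) y,
    two_form_swap ψ x (J y)]
  ring

theorem formZeroTwo_self (ψ : V [⋀^Fin 2]→ₗ[ℝ] ℂ) (x : V) : formZeroTwo J ψ x x = 0 :=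
  self_eq_neg.1 (formZeroTwo_swap ψ x x)

theorem formZeroTwo_add_left (ψ : V [⋀^Fin 2]→ₗ[ℝ] ℂ) (x x' y : V) :
    formZeroTwo J ψ (x + x') y = formZeroTwo J ψ x y + formZeroTwo J ψ x' y := by
  simp only [formZeroTwo, map_add, two_form_add_left]
  ring

theorem formZeroTwo_smul_left (ψ : V [⋀^Fin 2]→ₗ[ℝ] ℂ) (c : ℝ) (x y : V) :
    formZeroTwo J ψ (c • x) y = c * formZeroTwo J ψ x y := by
  simp only [formZeroTwo, map_smul, two_form_smul_left]
  ring

theorem formZeroTwo_J_left (hJ : ∀ v, J (J v) = -v) (ψ : V [⋀^Fin 2]→ₗ[ℝ] ℂ) (x y : V) :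
    formZeroTwo J ψ (J x) y = -Complex.I * formZeroTwo J ψ x y := by
  have h : ∀ a b, ψ ![-a, b] = -ψ ![a, b] := fun a b => by
    simpa using two_form_smul_left ψ (-1) a b
  simp only [formZeroTwo, hJ, h]
  linear_combination (ψ ![J x, y] + ψ ![x, J y]) * Complex.I_sq

theorem IsUnitaryBasis.apply_J (hU : IsUnitaryBasis g J α β γ) (v : V) :
    α (J v) = Complex.I * α v ∧ β (J v) = Complex.I * β v ∧ γ (J v) = Complex.I * γ v := by
  have h : ∀ θ ∈ ({α, β, γ} : Set (V →ₗ[ℝ] ℂ)), θ (J v) = Complex.I * θ v := fun θ hθ => by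
    have h' : θ ∈ formsOneZero J := hU.span_eq ▸ Submodule.subset_span hθ
    exact h' v
  exact ⟨h α (by simp), h β (by simp), h γ (by simp)⟩

/-- The Hermitian form `∑ θₖ(u) θ̄ₖ(v)` has real part `g(u, v)` and imaginary part `g(u, Jv)`. -/
theorem IsUnitaryBasis.sum_mul_conj (hU : IsUnitaryBasis g J α β γ)
    (hJ : IsOrthogonalComplexStructure g J) (u v : V) :
    α u * (starRingEnd ℂ) (α v) + β u * (starRingEnd ℂ) (β v) + γ u * (starRingEnd ℂ) (γ v) =
      g u v + Complex.I * g u (J v) := by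
  have h : ∀ u v, (α u * (starRingEnd ℂ) (α v) + β u * (starRingEnd ℂ) (β v) +
      γ u * (starRingEnd ℂ) (γ v)).im = g u (J v) := fun u v => by
    have h := congrArg Complex.re (hU.fundamentalForm_eq u v)
    simp only [AlternatingMap.add_apply, oneForm_wedge_apply, fundamentalForm,
      LinearMap.comp_apply, hJ.apply_left, bar_apply] at h
    simp at h ⊢
    linarith
  obtain ⟨ha, hb, hc⟩ := hU.apply_J u
  apply Complex.ext
  -- The Hermitian form is complex linear in `u`, so its real part at `u` is its imaginary part at
  -- `Ju`.
  · have h' := h (J u) v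
    rw [ha, hb, hc, hJ.orthogonal] at h'
    simp at h' ⊢
    linarith
  · rw [h]; simp

theorem IsUnitaryBasis.ext (hU : IsUnitaryBasis g J α β γ) (hg : IsInnerProduct g)
    (hJ : IsOrthogonalComplexStructure g J) {u v : V} (hα : α u = α v) (hβ : β u = β v)
    (hγ : γ u = γ v) : u = v := by
  by_contra h
  have h₁ := hg.pos (u - v) (sub_ne_zero.2 h)
  have h₂ := congrArg Complex.re (hU.sum_mul_conj hJ (u - v) (u - v))
  rw [map_sub α, map_sub β, map_sub γ, hα, hβ, hγ] at h₂
  simp only [sub_self, zero_mul, add_zero, Complex.zero_re, Complex.add_re, Complex.ofReal_re,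
    Complex.mul_re, Complex.I_re, Complex.I_im, Complex.ofReal_im, mul_zero] at h₂
  linarith

/-- `(α, β, γ) : V → ℂ³` is injective because `g` is definite, hence bijective since both sides have
real dimension 6. -/
theorem IsUnitaryBasis.exists_dualFrame (hU : IsUnitaryBasis g J α β γ) (hg : IsInnerProduct g)
    (hJ : IsOrthogonalComplexStructure g J) (hV : Module.finrank ℝ V = 6) :
    ∃ E₁ E₂ E₃, IsDualFrame α β γ E₁ E₂ E₃ := by
  have : FiniteDimensional ℝ V := Module.finite_of_finrank_pos (by omega)
  let Φ : V →ₗ[ℝ] ℂ × ℂ × ℂ := α.prod (β.prod γ)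
  have hinj : Function.Injective Φ := fun u v h =>
    hU.ext hg hJ (congrArg Prod.fst h) (congrArg (fun p => p.2.1) h)
      (congrArg (fun p => p.2.2) h)
  have hsurj : Function.Surjective Φ :=
    (LinearMap.injective_iff_surjective_of_finrank_eq_finrank
      (by simp [hV, Complex.finrank_real_complex])).1 hinj
  obtain ⟨E₁, h₁⟩ := hsurj (1, 0, 0)
  obtain ⟨E₂, h₂⟩ := hsurj (0, 1, 0)
  obtain ⟨E₃, h₃⟩ := hsurj (0, 0, 1)
  have hΦ : ∀ {E a}, Φ E = a → α E = a.1 ∧ β E = a.2.1 ∧ γ E = a.2.2 := by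
    rintro E _ rfl
    exact ⟨rfl, rfl, rfl⟩
  exact ⟨E₁, E₂, E₃, (hΦ h₁).1, (hΦ h₂).1, (hΦ h₃).1, (hΦ h₁).2.1, (hΦ h₂).2.1, (hΦ h₃).2.1,
    (hΦ h₁).2.2, (hΦ h₂).2.2, (hΦ h₃).2.2⟩

theorem IsUnitaryBasis.exists_basis (hU : IsUnitaryBasis g J α β γ)
    (hV : Module.finrank ℝ V = 6) (hE : IsDualFrame α β γ E₁ E₂ E₃) :
    ∃ b : Module.Basis (Fin 6) ℝ V, ⇑b = ![E₁, J E₁, E₂, J E₂, E₃, J E₃] := by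
  have hli : LinearIndependent ℝ ![E₁, J E₁, E₂, J E₂, E₃, J E₃] := by
    rw [Fintype.linearIndependent_iff]
    intro c hc
    simp only [Fin.sum_univ_six] at hc
    have h₁ := congrArg α hc
    have h₂ := congrArg β hc
    have h₃ := congrArg γ hc
    simp [hU.apply_J, hE.α₁, hE.α₂, hE.α₃, hE.β₁, hE.β₂, hE.β₃, hE.γ₁, hE.γ₂, hE.γ₃,
      Complex.ext_iff] at h₁ h₂ h₃
    intro i
    fin_cases i
    exacts [h₁.1, h₁.2, h₂.1, h₂.2, h₃.1, h₃.2]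
  exact ⟨basisOfLinearIndependentOfCardEqFinrank hli (by simp [hV]), by simp⟩

theorem IsUnitaryBasis.orthonormal (hU : IsUnitaryBasis g J α β γ)
    (hJ : IsOrthogonalComplexStructure g J) (hE : IsDualFrame α β γ E₁ E₂ E₃)
    (b : Module.Basis (Fin 6) ℝ V) (hb : ⇑b = ![E₁, J E₁, E₂, J E₂, E₃, J E₃]) (i j : Fin 6) :
    g (b i) (b j) = if i = j then 1 else 0 := by
  have h := congrArg Complex.re (hU.sum_mul_conj hJ (b i) (b j))
  have h' : g (b i) (b j) = ((g (b i) (b j) : ℂ) + Complex.I * g (b i) (J (b j))).re := by simp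
  rw [h', ← h, hb]
  fin_cases i <;> fin_cases j <;>
    simp [hU.apply_J, hE.α₁, hE.α₂, hE.α₃, hE.β₁, hE.β₂, hE.β₃, hE.γ₁, hE.γ₂, hE.γ₃]

theorem IsUnitaryBasis.eq_sum_frame (hU : IsUnitaryBasis g J α β γ) (hg : IsInnerProduct g)
    (hJ : IsOrthogonalComplexStructure g J) (hE : IsDualFrame α β γ E₁ E₂ E₃) (v : V) :
    v = (α v).re • E₁ + (α v).im • J E₁ + ((β v).re • E₂ + (β v).im • J E₂) +
      ((γ v).re • E₃ + (γ v).im • J E₃) := by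
  apply hU.ext hg hJ <;>
    simp [hU.apply_J, hE.α₁, hE.α₂, hE.α₃, hE.β₁, hE.β₂, hE.β₃, hE.γ₁, hE.γ₂, hE.γ₃]

/-- The (0,2)-part is conjugate-linear in its first argument, which is expanded in the frame. -/
theorem IsUnitaryBasis.formZeroTwo_eq_sum (hU : IsUnitaryBasis g J α β γ)
    (hg : IsInnerProduct g) (hJ : IsOrthogonalComplexStructure g J)
    (hE : IsDualFrame α β γ E₁ E₂ E₃) (ψ : V [⋀^Fin 2]→ₗ[ℝ] ℂ) (x y : V) :
    formZeroTwo J ψ x y = (starRingEnd ℂ) (α x) * formZeroTwo J ψ E₁ y +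
      (starRingEnd ℂ) (β x) * formZeroTwo J ψ E₂ y +
      (starRingEnd ℂ) (γ x) * formZeroTwo J ψ E₃ y := by
  have h : ∀ z : ℂ, (starRingEnd ℂ) z = z.re - z.im * Complex.I := fun z => by
    simp [Complex.ext_iff]
  conv_lhs => rw [hU.eq_sum_frame hg hJ hE x]
  simp only [formZeroTwo_add_left, formZeroTwo_smul_left, formZeroTwo_J_left hJ.sq, h]
  ring

theorem IsUnitaryBasis.formZeroTwo_eq (hU : IsUnitaryBasis g J α β γ)
    (hg : IsInnerProduct g) (hJ : IsOrthogonalComplexStructure g J)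
    (hE : IsDualFrame α β γ E₁ E₂ E₃) (ψ : V [⋀^Fin 2]→ₗ[ℝ] ℂ) (x y : V) :
    formZeroTwo J ψ x y =
      formZeroTwo J ψ E₂ E₃ * (starRingEnd ℂ) (β x * γ y - γ x * β y) +
      formZeroTwo J ψ E₃ E₁ * (starRingEnd ℂ) (γ x * α y - α x * γ y) +
      formZeroTwo J ψ E₁ E₂ * (starRingEnd ℂ) (α x * β y - β x * α y) := by
  have h : ∀ z, formZeroTwo J ψ z y = (starRingEnd ℂ) (α y) * formZeroTwo J ψ z E₁ +
      (starRingEnd ℂ) (β y) * formZeroTwo J ψ z E₂ +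
      (starRingEnd ℂ) (γ y) * formZeroTwo J ψ z E₃ := fun z => by
    rw [formZeroTwo_swap, hU.formZeroTwo_eq_sum hg hJ hE ψ y z, formZeroTwo_swap ψ E₁ z,
      formZeroTwo_swap ψ E₂ z, formZeroTwo_swap ψ E₃ z]
    ring
  rw [hU.formZeroTwo_eq_sum hg hJ hE ψ x y, h E₁, h E₂, h E₃]
  simp only [formZeroTwo_self]
  rw [formZeroTwo_swap ψ E₁ E₃, formZeroTwo_swap ψ E₂ E₁, formZeroTwo_swap ψ E₃ E₂]
  simp only [map_sub, map_mul]
  ring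

/-- The product with `βγαᾱ` kills every component of `ψ` except the one along `β̄γ̄`. The same
constant `-2i` occurs in the two cyclic analogues, so equations between 6-forms become equations
between components. -/
theorem IsUnitaryBasis.wedge_βγ_apply (hU : IsUnitaryBasis g J α β γ)
    (hE : IsDualFrame α β γ E₁ E₂ E₃) (ψ : V [⋀^Fin 2]→ₗ[ℝ] ℂ) :
    (ψ ⋏ β ⋏ γ ⋏ α ⋏ bar α) ![E₁, J E₁, E₂, J E₂, E₃, J E₃] =
      -2 * Complex.I * formZeroTwo J ψ E₂ E₃ := by
  have h : ∀ x, α (J x) = Complex.I * α x ∧ β (J x) = Complex.I * β x ∧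
    γ (J x) = Complex.I * γ x := hU.apply_J
  simp only [wedge_apply_three, wedge_apply_four, wedge_apply_five, wedge_apply_six, bar_apply,
    h, hE.α₁, hE.α₂, hE.α₃, hE.β₁, hE.β₂, hE.β₃, hE.γ₁, hE.γ₂, hE.γ₃, formZeroTwo, map_zero,
    map_one, Complex.conj_I, mul_zero, zero_mul, mul_one, one_mul, add_zero, zero_add,
    sub_zero, zero_sub, neg_zero]
  linear_combination 2 * Complex.I * ψ ![E₂, E₃] * Complex.I_sq

theorem IsUnitaryBasis.wedge_γα_apply (hU : IsUnitaryBasis g J α β γ)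
    (hE : IsDualFrame α β γ E₁ E₂ E₃) (ψ : V [⋀^Fin 2]→ₗ[ℝ] ℂ) :
    (ψ ⋏ γ ⋏ α ⋏ β ⋏ bar β) ![E₁, J E₁, E₂, J E₂, E₃, J E₃] =
      -2 * Complex.I * formZeroTwo J ψ E₃ E₁ := by
  have h : ∀ x, α (J x) = Complex.I * α x ∧ β (J x) = Complex.I * β x ∧
    γ (J x) = Complex.I * γ x := hU.apply_J
  simp only [wedge_apply_three, wedge_apply_four, wedge_apply_five, wedge_apply_six, bar_apply,
    h, hE.α₁, hE.α₂, hE.α₃, hE.β₁, hE.β₂, hE.β₃, hE.γ₁, hE.γ₂, hE.γ₃, formZeroTwo, map_zero,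
    map_one, Complex.conj_I, mul_zero, zero_mul, mul_one, one_mul, add_zero, zero_add,
    sub_zero, zero_sub, neg_zero]
  rw [two_form_swap ψ E₁ E₃, two_form_swap ψ (J E₁) E₃, two_form_swap ψ E₁ (J E₃),
    two_form_swap ψ (J E₁) (J E₃)]
  linear_combination 2 * Complex.I * ψ ![E₃, E₁] * Complex.I_sq

theorem IsUnitaryBasis.wedge_αβ_apply (hU : IsUnitaryBasis g J α β γ)
    (hE : IsDualFrame α β γ E₁ E₂ E₃) (ψ : V [⋀^Fin 2]→ₗ[ℝ] ℂ) :
    (ψ ⋏ α ⋏ β ⋏ γ ⋏ bar γ) ![E₁, J E₁, E₂, J E₂, E₃, J E₃] =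
      -2 * Complex.I * formZeroTwo J ψ E₁ E₂ := by
  have h : ∀ x, α (J x) = Complex.I * α x ∧ β (J x) = Complex.I * β x ∧
    γ (J x) = Complex.I * γ x := hU.apply_J
  simp only [wedge_apply_three, wedge_apply_four, wedge_apply_five, wedge_apply_six, bar_apply,
    h, hE.α₁, hE.α₂, hE.α₃, hE.β₁, hE.β₂, hE.β₃, hE.γ₁, hE.γ₂, hE.γ₃, formZeroTwo, map_zero,
    map_one, Complex.conj_I, mul_zero, zero_mul, mul_one, one_mul, add_zero, zero_add,
    sub_zero, zero_sub, neg_zero]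
  linear_combination 2 * Complex.I * ψ ![E₁, E₂] * Complex.I_sq

end Coframe

/-! ### `∇ω` and the (0,2)-parts of the structure equations -/

section Koszul

variable {V : Type*} [LieRing V] [LieAlgebra ℝ V]

/-- The tensor `(∇_X ω)(Y, Z)` at the identity of a Lie group, by the Koszul formula. -/
def koszulTensor (g : V →ₗ[ℝ] V →ₗ[ℝ] ℝ) (J : V →ₗ[ℝ] V) : V →ₗ[ℝ] V →ₗ[ℝ] V →ₗ[ℝ] ℝ :=
  mkTrilinear (fun x y z =>
      1 / 2 * (g ⁅x, y⁆ (J z) - g ⁅y, J z⁆ x + g ⁅J z, x⁆ y +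
        (g ⁅x, J y⁆ z - g ⁅J y, z⁆ x + g ⁅z, x⁆ (J y))))
    (fun _ _ _ _ => by simp; ring) (fun _ _ _ _ => by simp; ring)
    (fun _ _ _ _ => by simp; ring) (fun _ _ _ _ => by simp; ring)
    (fun _ _ _ _ => by simp; ring) (fun _ _ _ _ => by simp; ring)

theorem koszulTensor_apply (g : V →ₗ[ℝ] V →ₗ[ℝ] ℝ) (J : V →ₗ[ℝ] V) (x y z : V) :
    koszulTensor g J x y z =
      1 / 2 * (g ⁅x, y⁆ (J z) - g ⁅y, J z⁆ x + g ⁅J z, x⁆ y +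
        (g ⁅x, J y⁆ z - g ⁅J y, z⁆ x + g ⁅z, x⁆ (J y))) := rfl

variable {g : V →ₗ[ℝ] V →ₗ[ℝ] ℝ} {J : V →ₗ[ℝ] V} {α β γ : V →ₗ[ℝ] ℂ} {E₁ E₂ E₃ : V}
  {a b c : V [⋀^Fin 2]→ₗ[ℝ] ℂ}

theorem apply_lie_swap (g : V →ₗ[ℝ] V →ₗ[ℝ] ℝ) (x y z : V) : g ⁅x, y⁆ z = -g ⁅y, x⁆ z := by
  rw [← lie_skew, map_neg, LinearMap.neg_apply]

theorem koszulTensor_mem_spaceW (hJ : ∀ v, J (J v) = -v) : koszulTensor g J ∈ spaceW J := by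
  refine ⟨fun x y z => ?_, fun x y z => ?_⟩
  · simp only [koszulTensor_apply]
    rw [apply_lie_swap g x z, apply_lie_swap g z (J y), apply_lie_swap g (J y) x,
      apply_lie_swap g x (J z), apply_lie_swap g (J z) y, apply_lie_swap g y x]
    ring
  · simp only [koszulTensor_apply, hJ, map_neg, neg_lie, lie_neg, LinearMap.neg_apply]
    ring

/-- The two bracket combinations that survive are those in `formZeroTwo J (dθ) z x`, for which
`dθ(X, Y) = -θ[X, Y]`. -/
theorem koszulTensor_self_sub (hJ : ∀ v, J (J v) = -v) (x z : V) :
    koszulTensor g J x x z - koszulTensor g J (J x) (J x) z =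
      g (⁅z, x⁆ - ⁅J z, J x⁆) (J x) + g (⁅J z, x⁆ + ⁅z, J x⁆) x := by
  simp only [koszulTensor_apply, hJ, map_neg, neg_lie, lie_neg, LinearMap.neg_apply, lie_self,
    map_zero, LinearMap.zero_apply, map_add, map_sub, LinearMap.add_apply, LinearMap.sub_apply]
  rw [apply_lie_swap g x (J z), apply_lie_swap g (J x) z, apply_lie_swap g (J x) (J z),
    apply_lie_swap g (J x) x, apply_lie_swap g x z]
  ring

/-- The contraction of the (0,2)-parts of the 2-forms `a, b, c` with `ᾱ, β̄, γ̄`. -/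
def contractedZeroTwo (J : V →ₗ[ℝ] V) (α β γ : V →ₗ[ℝ] ℂ) (a b c : V [⋀^Fin 2]→ₗ[ℝ] ℂ)
    (x z : V) : ℂ :=
  formZeroTwo J a z x * (starRingEnd ℂ) (α x) + formZeroTwo J b z x * (starRingEnd ℂ) (β x) +
    formZeroTwo J c z x * (starRingEnd ℂ) (γ x)

/-- Summing over the coframe turns `θₖ(u) θ̄ₖ(x)` into the Hermitian form of `g`, which translates
the contraction into the pairings of `koszulTensor_self_sub`. -/
theorem IsUnitaryBasis.im_contractedZeroTwo (hU : IsUnitaryBasis g J α β γ)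
    (hJ : IsOrthogonalComplexStructure g J) (ha : ∀ x y, a ![x, y] = -α ⁅x, y⁆)
    (hb : ∀ x y, b ![x, y] = -β ⁅x, y⁆) (hc : ∀ x y, c ![x, y] = -γ ⁅x, y⁆) (x z : V) :
    (contractedZeroTwo J α β γ a b c x z).im =
      koszulTensor g J (J x) (J x) z - koszulTensor g J x x z := by
  have h₁ := hU.sum_mul_conj hJ (⁅z, x⁆ - ⁅J z, J x⁆) x
  have h₂ := hU.sum_mul_conj hJ (⁅J z, x⁆ + ⁅z, J x⁆) x
  have h₃ : contractedZeroTwo J α β γ a b c x z =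
      -(g (⁅z, x⁆ - ⁅J z, J x⁆) x + Complex.I * g (⁅z, x⁆ - ⁅J z, J x⁆) (J x)) -
      Complex.I * (g (⁅J z, x⁆ + ⁅z, J x⁆) x + Complex.I * g (⁅J z, x⁆ + ⁅z, J x⁆) (J x)) := by
    rw [← h₁, ← h₂]
    simp only [contractedZeroTwo, formZeroTwo, ha, hb, hc, map_add, map_sub]
    ring
  have h₄ := koszulTensor_self_sub (g := g) hJ.sq x z
  rw [h₃]
  simp only [Complex.add_im, Complex.sub_im, Complex.neg_im, Complex.mul_im, Complex.mul_re,
    Complex.add_re, Complex.I_re, Complex.I_im, Complex.ofReal_re, Complex.ofReal_im]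
  linarith

theorem IsUnitaryBasis.koszulTensor_self_iff (hU : IsUnitaryBasis g J α β γ)
    (hJ : IsOrthogonalComplexStructure g J) (ha : ∀ x y, a ![x, y] = -α ⁅x, y⁆)
    (hb : ∀ x y, b ![x, y] = -β ⁅x, y⁆) (hc : ∀ x y, c ![x, y] = -γ ⁅x, y⁆) :
    (∀ x z, koszulTensor g J x x z = koszulTensor g J (J x) (J x) z) ↔
      ∀ x z, contractedZeroTwo J α β γ a b c x z = 0 := by
  have him := hU.im_contractedZeroTwo hJ ha hb hc
  constructor
  · intro h x z
    apply Complex.ext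
    -- The factor `-i` turns the known vanishing of the imaginary part at `Jz` into vanishing of the
    -- real part at `z`.
    · have h₁ : contractedZeroTwo J α β γ a b c x (J z) =
          -Complex.I * contractedZeroTwo J α β γ a b c x z := by
        simp only [contractedZeroTwo, formZeroTwo_J_left hJ.sq]
        ring
      have h₂ := congrArg Complex.im h₁
      rw [him, h x (J z)] at h₂
      simpa using h₂
    · rw [him, h x z]; simp
  · intro h x z
    have h₁ := him x z
    rw [h, Complex.zero_im] at h₁
    linarith

/-- The (0,2)-parts of `a, b, c` contract to zero if and only if their matrix with respect to
the coframe is a multiple of the identity. -/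
theorem IsUnitaryBasis.contractedZeroTwo_eq_zero_iff (hU : IsUnitaryBasis g J α β γ)
    (hg : IsInnerProduct g) (hJ : IsOrthogonalComplexStructure g J)
    (hE : IsDualFrame α β γ E₁ E₂ E₃) :
    (∀ x z, contractedZeroTwo J α β γ a b c x z = 0) ↔
      formZeroTwo J a E₃ E₁ = 0 ∧ formZeroTwo J a E₁ E₂ = 0 ∧
      formZeroTwo J b E₁ E₂ = 0 ∧ formZeroTwo J b E₂ E₃ = 0 ∧
      formZeroTwo J c E₂ E₃ = 0 ∧ formZeroTwo J c E₃ E₁ = 0 ∧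
      formZeroTwo J a E₂ E₃ = formZeroTwo J b E₃ E₁ ∧
      formZeroTwo J b E₃ E₁ = formZeroTwo J c E₁ E₂ := by
  constructor
  · intro h
    -- The right-hand side is left open and is filled in by the rewriting: `key x z` equates `0`
    -- with the contraction in components.
    have key := fun x z => (h x z).symm.trans (by
      rw [contractedZeroTwo, hU.formZeroTwo_eq hg hJ hE a z x, hU.formZeroTwo_eq hg hJ hE b z x,
        hU.formZeroTwo_eq hg hJ hE c z x])
    have h₁₂ := key E₁ E₂
    have h₁₃ := key E₁ E₃
    have h₂₁ := key E₂ E₁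
    have h₂₃ := key E₂ E₃
    have h₃₁ := key E₃ E₁
    have h₃₂ := key E₃ E₂
    -- Frame vectors alone give only the off-diagonal entries; the sums compare diagonal entries.
    have h₁₂₃ := key (E₁ + E₂) E₃
    have h₂₃₁ := key (E₂ + E₃) E₁
    simp only [map_add, hE.α₁, hE.α₂, hE.α₃, hE.β₁, hE.β₂, hE.β₃, hE.γ₁, hE.γ₂, hE.γ₃,
      mul_zero, mul_one, sub_zero, zero_sub, map_neg, map_zero, map_one,
      add_zero, zero_add, sub_self, mul_neg] at h₁₂ h₁₃ h₂₁ h₂₃ h₃₁ h₃₂ h₁₂₃ h₂₃₁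
    refine ⟨?_, ?_, ?_, ?_, ?_, ?_, ?_, ?_⟩ <;> grind
  · rintro ⟨h₁, h₂, h₃, h₄, h₅, h₆, h₇, h₈⟩ x z
    rw [contractedZeroTwo, hU.formZeroTwo_eq hg hJ hE a z x, hU.formZeroTwo_eq hg hJ hE b z x,
      hU.formZeroTwo_eq hg hJ hE c z x, h₁, h₂, h₃, h₄, h₅, h₆, h₇, h₈]
    simp only [map_sub, map_mul]
    ring

/-- The characterization of the class `𝒲₁ ⊕ 𝒲₃ ⊕ 𝒲₄` on a 6-dimensional Lie algebra. -/
theorem IsUnitaryBasis.koszulTensor_mem_iff (hU : IsUnitaryBasis g J α β γ)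
    (hg : IsInnerProduct g) (hJ : IsOrthogonalComplexStructure g J)
    (hV : Module.finrank ℝ V = 6) (ha : ∀ x y, a ![x, y] = -α ⁅x, y⁆)
    (hb : ∀ x y, b ![x, y] = -β ⁅x, y⁆) (hc : ∀ x y, c ![x, y] = -γ ⁅x, y⁆) :
    koszulTensor g J ∈ spaceW1 J ⊔ spaceW3 g J ⊔ spaceW4 g J ↔
      a ⋏ γ ⋏ α ⋏ β ⋏ bar β = 0 ∧
      a ⋏ α ⋏ β ⋏ γ ⋏ bar γ = 0 ∧
      b ⋏ α ⋏ β ⋏ γ ⋏ bar γ = 0 ∧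
      b ⋏ β ⋏ γ ⋏ α ⋏ bar α = 0 ∧
      c ⋏ β ⋏ γ ⋏ α ⋏ bar α = 0 ∧
      c ⋏ γ ⋏ α ⋏ β ⋏ bar β = 0 ∧
      a ⋏ β ⋏ γ ⋏ α ⋏ bar α = b ⋏ γ ⋏ α ⋏ β ⋏ bar β ∧
      b ⋏ γ ⋏ α ⋏ β ⋏ bar β = c ⋏ α ⋏ β ⋏ γ ⋏ bar γ := by
  obtain ⟨E₁, E₂, E₃, hE⟩ := hU.exists_dualFrame hg hJ hV
  obtain ⟨e, he⟩ := hU.exists_basis hV hE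
  rw [mem_spaceW134_iff hg hJ (by norm_num) e (hU.orthonormal hJ hE e he)
    (koszulTensor_mem_spaceW hJ.sq), hU.koszulTensor_self_iff hJ ha hb hc,
    hU.contractedZeroTwo_eq_zero_iff hg hJ hE]
  have hext : ∀ φ ψ : V [⋀^Fin 6]→ₗ[ℝ] ℂ, φ = ψ ↔
      φ ![E₁, J E₁, E₂, J E₂, E₃, J E₃] = ψ ![E₁, J E₁, E₂, J E₂, E₃, J E₃] := fun φ ψ =>
    ⟨fun h => h ▸ rfl, fun h => eq_of_apply_basis_eq e (he ▸ h)⟩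
  have hI : -2 * Complex.I ≠ 0 := by simp
  simp only [hext, hU.wedge_βγ_apply hE, hU.wedge_γα_apply hE, hU.wedge_αβ_apply hE,
    AlternatingMap.zero_apply, mul_eq_zero, hI, false_or, mul_right_inj' hI]

end Koszul

/-! ### The Levi-Civita connection on left-invariant fields -/

section LeviCivita

variable {G : Type*} [TopologicalSpace G] [ChartedSpace (EuclideanSpace ℝ (Fin 6)) G] [Group G]
  [LieGroup (𝓡 6) ∞ G]

theorem toLieAlgebra_mulInvariantVectorField (X : GroupLieAlgebra (𝓡 6) G) (x : G) :
    toLieAlgebra x (mulInvariantVectorField X x) = X := by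
  have M : minSmoothness ℝ 3 ≠ 0 := lt_of_lt_of_le (by simp) le_minSmoothness |>.ne'
  have h : mfderiv (𝓡 6) (𝓡 6) ((fun y : G => x⁻¹ * y) ∘ (fun y : G => x * y)) 1 =
      ContinuousLinearMap.id _ _ := by
    have : (fun y : G => x⁻¹ * y) ∘ (fun y => x * y) = id := by ext y; simp
    rw [this, id_eq, mfderiv_id]
  rw [mfderiv_comp (I' := 𝓡 6) _
    ((contMDiff_mul_left (n := minSmoothness ℝ 3)).contMDiffAt.mdifferentiableAt M)
    ((contMDiff_mul_left (n := minSmoothness ℝ 3)).contMDiffAt.mdifferentiableAt M)] at h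
  -- The chain rule yields the derivative at `x * 1`, which is only propositionally `x`;
  -- generalizing the point avoids a cast between tangent spaces.
  have key : ∀ y : G, y = x * 1 →
      (mfderiv (𝓡 6) (𝓡 6) (fun y : G => x⁻¹ * y) y :
        EuclideanSpace ℝ (Fin 6) →L[ℝ] EuclideanSpace ℝ (Fin 6))
        (mfderiv (𝓡 6) (𝓡 6) (fun y : G => x * y) 1 X) = X := by
    rintro _ rfl
    exact congrArg (fun L => L X) h
  exact key x (mul_one x).symm

theorem invariantTensor_mulInvariantVectorField
    (b : GroupLieAlgebra (𝓡 6) G →ₗ[ℝ] GroupLieAlgebra (𝓡 6) G →ₗ[ℝ] ℝ)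
    (X Y : GroupLieAlgebra (𝓡 6) G) (x : G) :
    invariantTensor b x (mulInvariantVectorField X x) (mulInvariantVectorField Y x) = b X Y := by
  simp only [invariantTensor, toLieAlgebra_mulInvariantVectorField]

theorem isDifferentiableField_mulInvariantVectorField (X : GroupLieAlgebra (𝓡 6) G) (x : G) :
    IsDifferentiableField (mulInvariantVectorField X) x :=
  mdifferentiableAt_mulInvariantVectorField X

/-- `∇_X Y` at the point `x` for left-invariant `X` and `Y`, as an element of the Lie algebra. -/
def invariantCov (cov : CovariantDerivative (𝓡 6) (EuclideanSpace ℝ (Fin 6))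
      (TangentSpace (𝓡 6) : G → Type _)) (x : G) (X Y : GroupLieAlgebra (𝓡 6) G) :
    GroupLieAlgebra (𝓡 6) G :=
  toLieAlgebra x (cov (mulInvariantVectorField Y) x (mulInvariantVectorField X x))

variable {g : GroupLieAlgebra (𝓡 6) G →ₗ[ℝ] GroupLieAlgebra (𝓡 6) G →ₗ[ℝ] ℝ}
  {cov : CovariantDerivative (𝓡 6) (EuclideanSpace ℝ (Fin 6))
      (TangentSpace (𝓡 6) : G → Type _)}

theorem IsLeviCivita.invariantCov_sub (hcov : IsLeviCivita g cov) (x : G)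
    (X Y : GroupLieAlgebra (𝓡 6) G) :
    invariantCov cov x X Y - invariantCov cov x Y X = ⁅X, Y⁆ := by
  rw [invariantCov, invariantCov, ← map_sub, hcov.torsion_free _ _ x
    (isDifferentiableField_mulInvariantVectorField X x)
    (isDifferentiableField_mulInvariantVectorField Y x), ← mulInvariantVector_mlieBracket,
    toLieAlgebra_mulInvariantVectorField]
  rfl

theorem IsLeviCivita.invariantCov_metric (hcov : IsLeviCivita g cov) (x : G)
    (X Y Z : GroupLieAlgebra (𝓡 6) G) :
    g (invariantCov cov x X Y) Z + g Y (invariantCov cov x X Z) = 0 := by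
  have h := hcov.metric (mulInvariantVectorField X) (mulInvariantVectorField Y)
    (mulInvariantVectorField Z) x (isDifferentiableField_mulInvariantVectorField Y x)
    (isDifferentiableField_mulInvariantVectorField Z x)
  -- `g(Y, Z)` is constant for left-invariant fields, so its derivative drops out.
  simp only [invariantTensor_mulInvariantVectorField, mvfderiv_const] at h
  simp only [invariantTensor, toLieAlgebra_mulInvariantVectorField] at h
  exact h.symm

/-- The Koszul formula for left-invariant fields. -/
theorem IsLeviCivita.koszul (hcov : IsLeviCivita g cov) (hg : IsInnerProduct g) (x : G)
    (X Y Z : GroupLieAlgebra (𝓡 6) G) :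
    g (invariantCov cov x X Y) Z = 1 / 2 * (g ⁅X, Y⁆ Z - g ⁅Y, Z⁆ X + g ⁅Z, X⁆ Y) := by
  have h₁ := hcov.invariantCov_metric x X Y Z
  have h₂ := hcov.invariantCov_metric x Y Z X
  have h₃ := hcov.invariantCov_metric x Z X Y
  simp only [← hcov.invariantCov_sub x, map_sub, LinearMap.sub_apply]
  rw [hg.symm Y] at h₁
  rw [hg.symm Z] at h₂
  rw [hg.symm X] at h₃
  linarith

/-- Metric compatibility gives `(∇_X ω)(Y, Z) = g(∇_X Y, JZ) + g(∇_X (JY), Z)`, and the Koszul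
formula applies to each term. -/
theorem IsLeviCivita.covDeriv_fundamentalForm (hcov : IsLeviCivita g cov)
    (hg : IsInnerProduct g) {J : GroupLieAlgebra (𝓡 6) G →ₗ[ℝ] GroupLieAlgebra (𝓡 6) G}
    (hJ : IsOrthogonalComplexStructure g J) (x : G) (X Y Z : GroupLieAlgebra (𝓡 6) G) :
    covDeriv cov (fundamentalForm g J) x X Y Z = koszulTensor g J X Y Z := by
  have h : covDeriv cov (fundamentalForm g J) x X Y Z =
      -g (J (invariantCov cov x X Y)) Z - g (J Y) (invariantCov cov x X Z) := by
    simp only [covDeriv, invariantTensor_mulInvariantVectorField, mvfderiv_const]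
    simp only [invariantTensor, toLieAlgebra_mulInvariantVectorField]
    simp [fundamentalForm, invariantCov]
  have h₁ := hcov.invariantCov_metric x X (J Y) Z
  have h₂ := hcov.koszul hg x X Y (J Z)
  have h₃ := hcov.koszul hg x X (J Y) Z
  rw [h, hJ.apply_left, koszulTensor_apply]
  linarith

end LeviCivita

end AlmostHermitian

end

open AlmostHermitian in
theorem lemma2 {G : Type*} [TopologicalSpace G] [ChartedSpace (EuclideanSpace ℝ (Fin 6)) G]
    [Group G] [LieGroup (𝓡 6) ∞ G]
    (g : GroupLieAlgebra (𝓡 6) G →ₗ[ℝ] GroupLieAlgebra (𝓡 6) G →ₗ[ℝ] ℝ)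
    (hg : IsInnerProduct g)
    (o : Orientation ℝ (GroupLieAlgebra (𝓡 6) G) (Fin 6))
    (cov : CovariantDerivative (𝓡 6) (EuclideanSpace ℝ (Fin 6))
      (TangentSpace (𝓡 6) : G → Type _))
    (hcov : IsLeviCivita g cov)
    (J : GroupLieAlgebra (𝓡 6) G →ₗ[ℝ] GroupLieAlgebra (𝓡 6) G)
    (hJ : J ∈ classZ g o)
    (α β γ : GroupLieAlgebra (𝓡 6) G →ₗ[ℝ] ℂ)
    (hαβγ : IsUnitaryBasis g J α β γ) :
    J ∈ classZ134 g o cov ↔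
      dForm α ⋏ γ ⋏ α ⋏ β ⋏ bar β = 0 ∧
      dForm α ⋏ α ⋏ β ⋏ γ ⋏ bar γ = 0 ∧
      dForm β ⋏ α ⋏ β ⋏ γ ⋏ bar γ = 0 ∧
      dForm β ⋏ β ⋏ γ ⋏ α ⋏ bar α = 0 ∧
      dForm γ ⋏ β ⋏ γ ⋏ α ⋏ bar α = 0 ∧
      dForm γ ⋏ γ ⋏ α ⋏ β ⋏ bar β = 0 ∧
      dForm α ⋏ β ⋏ γ ⋏ α ⋏ bar α = dForm β ⋏ γ ⋏ α ⋏ β ⋏ bar β ∧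
      dForm β ⋏ γ ⋏ α ⋏ β ⋏ bar β = dForm γ ⋏ α ⋏ β ⋏ γ ⋏ bar γ := by
  have hV : Module.finrank ℝ (GroupLieAlgebra (𝓡 6) G) = 6 :=
    finrank_euclideanSpace_fin (𝕜 := ℝ) (n := 6)
  rw [← hαβγ.koszulTensor_mem_iff hg hJ.1 hV (a := dForm α) (b := dForm β) (c := dForm γ)
    (fun _ _ => rfl) (fun _ _ => rfl) (fun _ _ => rfl)]
  constructor
  · rintro ⟨-, h⟩
    -- The tensor is the same at every point, so the identity suffices.
    obtain ⟨T, hT, hT'⟩ := h 1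
    have hK : koszulTensor g J = T := by
      ext X Y Z
      rw [hT', hcov.covDeriv_fundamentalForm hg hJ.1]
    exact hK ▸ hT
  · intro h
    exact ⟨hJ, fun x => ⟨_, h, fun X Y Z => (hcov.covDeriv_fundamentalForm hg hJ.1 x X Y Z).symm⟩⟩
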